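/- **Setting.** Let $n,m\ge 1$, $\varepsilon>0$, and let $A_1,\dots,A_m$ be nonzero positive semidefinite complex $n\times n$ matrices with $\|A_i\|\le 1$ (spectral norm) all of whose nonzero eigenvalues are at least $1/\gamma$, where $\gamma=m^2/\varepsilon^2$. Put $\varepsilon_0=\varepsilon^2/\ln^2 n$ and $\varepsilon_1=3\varepsilon/\ln n$. For a matrix $X$ let $\Phi(X)=\mathrm{Diag}(\mathrm{tr}\,A_1X,\dots,\mathrm{tr}\,A_mX)$, and for a diagonal matrix $Y=\mathrm{Diag}(y_1,\dots,y_m)$ let $\Phi^*(Y)=\sum_i y_iA_i$. For a Hermitian matrix $B$ and $l\in\mathbb R$ let $N_l(B)$ be the sum (with multiplicity) of the eigenvalues of $B$ that are at least $l$. **Algorithm** (with exact arithmetic). 1. Let $t=0$, $X_0=0$, and let $k=k_s$ be the integer with $(1+\varepsilon_0)^{k_s}\le\|\Phi^*(I)\|<(1+\varepsilon_0)^{k_s+1}$. 2. Let $Y_t=\exp(-\Phi(X_t))=\mathrm{Diag}(y_1,\dots,y_m)$. If $\mathrm{tr}\,Y_t\le 1/m^{1/\varepsilon}$, stop. Otherwise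 perform one *iteration*, consisting of (a)–(d): - (a) While $\|\Phi^*(Y_t)\|<(1+\varepsilon_0)^k$, replace $k$ by $k-1$. The resulting $k$ is the *phase value* of the iteration. - (b) Start with $\mathrm{thr}=k$; while $N_{(1+\varepsilon_0)^{\mathrm{thr}-1}}(\Phi^*(Y_t))\ge(1+\tfrac25\varepsilon)\,N_{(1+\varepsilon_0)^{\mathrm{thr}}}(\Phi^*(Y_t))$, replace $\mathrm{thr}$ by $\mathrm{thr}-1$. - (c) Let $\Pi_t$ be the orthogonal projector onto the span of the eigenvectors of $\Phi^*(Y_t)$ with eigenvalue at least $(1+\varepsilon_0)^{\mathrm{thr}}$. Order the indices so that $\mathrm{tr}\,A_{j_1}\Pi_t\ge\dots\ge\mathrm{tr}\,A_{j_m}\Pi_t$, choose any $r\in[m]$ with $\sum_{q\le r}y_{j_q}\mathrm{tr}\,A_{j_q}\Pi_t\ge\sqrt\varepsilon\,\sum_{q=1}^m y_{j_q}\mathrm{tr}\,A_{j_q}\Pi_t$ and $\sum_{q\ge r}y_{j_q}\mathrm{tr}\,A_{j_q}\Pi_t\ge(1-\sqrt\varepsilon)\sum_{q=1}^m y_{j_q}\mathrm{tr}\,A_{j_q}\Pi_t$,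 and let $\lambda_t=2\sqrt\varepsilon/\mathrm{tr}\,A_{j_r}\Pi_t$. - (d) Let $X_{t+1}=X_t+\lambda_t\Pi_t$, increase $t$ by $1$, and go to step 2. **Theorem.** There are absolute constants $C>0$, $\varepsilon_{\max}>0$ and $n_{\min}$ such that for all $n\ge n_{\min}$, all $m\ge1$, all $0<\varepsilon\le\varepsilon_{\max}$ and all $A_1,\dots,A_m$ as above, the algorithm is well defined (it can be started, and whenever it has not stopped the next iteration can be carried out), and for every execution, whatever choices are made in (c): * for each fixed $k$, the number of iterations with phase value $k$ is at most $C\,\dfrac{\log^2 n}{\varepsilon_1^{9}\,\varepsilon}$; * the initial value $k_s$ and the final value $k_f$ of $k$ satisfy $k_s-k_f\le C\,\dfrac{\log m\,\log^2 n}{\varepsilon^3}$; * the total number of iterations is at most $C\,\dfrac{\log^{13}n\,\log m}{\varepsilon^{13}}$; in particular the algorithm always stops. -/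

import Mathlib

open scoped ComplexOrder

noncomputable section

namespace PosSDP

/-- The spectral norm (the operator norm for the Euclidean norm) of a square complex matrix. -/
def opNorm {n : ℕ} (M : Matrix (Fin n) (Fin n) ℂ) : ℝ :=
  ‖Matrix.toEuclideanCLM (n := Fin n) (𝕜 := ℂ) M‖

/-- The orthogonal projector onto the span of the eigenvectors of the Hermitian matrix `B` whose
eigenvalue is at least `l` (the functional calculus of `B` applied to the indicator of
`[l, ∞)`). -/
def eigProj {n : ℕ} {B : Matrix (Fin n) (Fin n) ℂ} (hB : B.IsHermitian) (l : ℝ) :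
    Matrix (Fin n) (Fin n) ℂ :=
  hB.cfc (fun x : ℝ => if l ≤ x then 1 else 0)

/-- `N_l(B)`: the sum, with multiplicity, of the eigenvalues of the Hermitian matrix `B` that are
at least `l`. -/
def eigSum {n : ℕ} {B : Matrix (Fin n) (Fin n) ℂ} (hB : B.IsHermitian) (l : ℝ) : ℝ :=
  ∑ j with l ≤ hB.eigenvalues j, hB.eigenvalues j

/-- The diagonal matrix `Φ(X) = Diag(tr A₁X, …, tr AₘX)`. (For Hermitian `A i` and `X` the traces
are real.) -/
def Phi {n m : ℕ} (A : Fin m → Matrix (Fin n) (Fin n) ℂ) (X : Matrix (Fin n) (Fin n) ℂ) :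
    Matrix (Fin m) (Fin m) ℝ :=
  Matrix.diagonal (fun i => (A i * X).trace.re)

/-- The adjoint map `Φ*(Y) = ∑ i, Y(i,i) A i`. -/
def PhiStar {n m : ℕ} (A : Fin m → Matrix (Fin n) (Fin n) ℂ) (Y : Matrix (Fin m) (Fin m) ℝ) :
    Matrix (Fin n) (Fin n) ℂ :=
  ∑ i, ((Y i i : ℝ) : ℂ) • A i

theorem isHermitian_PhiStar {n m : ℕ} {A : Fin m → Matrix (Fin n) (Fin n) ℂ}
    (hA : ∀ i, (A i).IsHermitian) (Y : Matrix (Fin m) (Fin m) ℝ) :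
    (PhiStar A Y).IsHermitian := by
  unfold PhiStar Matrix.IsHermitian
  rw [Matrix.conjTranspose_sum]
  refine Finset.sum_congr rfl fun i _ => ?_
  rw [Matrix.conjTranspose_smul, (hA i).eq]
  simp

/-- The dual variable `Y = exp(-Φ(X))` (a matrix exponential). -/
def dualVar {n m : ℕ} (A : Fin m → Matrix (Fin n) (Fin n) ℂ) (X : Matrix (Fin n) (Fin n) ℂ) :
    Matrix (Fin m) (Fin m) ℝ :=
  NormedSpace.exp (-(Phi A X))

/-- `ε₀ = ε² / ln² n`. -/
def eps0 (n : ℕ) (ε : ℝ) : ℝ := ε ^ 2 / Real.log n ^ 2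

/-- `ε₁ = 3ε / ln n`. -/
def eps1 (n : ℕ) (ε : ℝ) : ℝ := 3 * ε / Real.log n

/-- The input of the algorithm, a positive semidefinite program in special form: nonzero positive
semidefinite matrices of norm at most `1` whose nonzero eigenvalues are at least `1/γ`, where
`γ = m²/ε²`. -/
structure SpecialForm {n m : ℕ} (ε : ℝ) (A : Fin m → Matrix (Fin n) (Fin n) ℂ) : Prop where
  posSemidef : ∀ i, (A i).PosSemidef
  ne_zero : ∀ i, A i ≠ 0
  norm_le_one : ∀ i, opNorm (A i) ≤ 1
  eigenvalue_ge : ∀ i j, (posSemidef i).isHermitian.eigenvalues j ≠ 0 →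
    1 / ((m : ℝ) ^ 2 / ε ^ 2) ≤ (posSemidef i).isHermitian.eigenvalues j

/-- The state carried from one iteration to the next: the primal variable `X_t` and the phase
value `k`. -/
structure State (n : ℕ) where
  X : Matrix (Fin n) (Fin n) ℂ
  k : ℤ

/-- The state after initialization: `X₀ = 0` and `k = k_s`, where `k_s` is the integer with
`(1+ε₀)^{k_s} ≤ ‖Φ*(I)‖ < (1+ε₀)^{k_s+1}`. -/
def IsInitial {n m : ℕ} (ε : ℝ) (A : Fin m → Matrix (Fin n) (Fin n) ℂ) (s : State n) : Prop :=
  s.X = 0 ∧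
  (1 + eps0 n ε) ^ s.k ≤ opNorm (PhiStar A 1) ∧
  opNorm (PhiStar A 1) < (1 + eps0 n ε) ^ (s.k + 1)

/-- The main loop stops as soon as `tr Y_t ≤ 1 / m^{1/ε}`. -/
def Halted {n m : ℕ} (ε : ℝ) (A : Fin m → Matrix (Fin n) (Fin n) ℂ) (s : State n) : Prop :=
  (dualVar A s.X).trace ≤ 1 / (m : ℝ) ^ (1 / ε)

/-- The phase update: starting from `k`, the phase value is decreased by one as long as
`‖Φ*(Y)‖ < (1+ε₀)^k`; the loop ends with the value `k'`. -/
def PhaseUpdate {n m : ℕ} (ε : ℝ) (A : Fin m → Matrix (Fin n) (Fin n) ℂ)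
    (Y : Matrix (Fin m) (Fin m) ℝ) (k k' : ℤ) : Prop :=
  k' ≤ k ∧
  (∀ j : ℤ, k' < j → j ≤ k → opNorm (PhiStar A Y) < (1 + eps0 n ε) ^ j) ∧
  ¬ opNorm (PhiStar A Y) < (1 + eps0 n ε) ^ k'

/-- The test of the threshold loop:
`N_{(1+ε₀)^{s-1}}(Φ*(Y)) ≥ (1 + 2ε/5) N_{(1+ε₀)^s}(Φ*(Y))`. -/
def ThrTest {n m : ℕ} (ε : ℝ) {A : Fin m → Matrix (Fin n) (Fin n) ℂ}
    (hA : ∀ i, (A i).IsHermitian) (Y : Matrix (Fin m) (Fin m) ℝ) (s : ℤ) : Prop :=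
  (1 + 2 / 5 * ε) * eigSum (isHermitian_PhiStar hA Y) ((1 + eps0 n ε) ^ s) ≤
    eigSum (isHermitian_PhiStar hA Y) ((1 + eps0 n ε) ^ (s - 1))

/-- The threshold search: starting from the phase value `k`, the threshold is decreased by one as
long as the test succeeds; the loop ends with the value `thr`. -/
def ThresholdSearch {n m : ℕ} (ε : ℝ) {A : Fin m → Matrix (Fin n) (Fin n) ℂ}
    (hA : ∀ i, (A i).IsHermitian) (Y : Matrix (Fin m) (Fin m) ℝ) (k thr : ℤ) : Prop :=
  thr ≤ k ∧ (∀ s : ℤ, thr < s → s ≤ k → ThrTest ε hA Y s) ∧ ¬ ThrTest ε hA Y thr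

/-- The choice of the step length `lam` for the projector `P`: the numbers `tr A_i P` are sorted in
non-increasing order by a permutation `σ`, `r` is an index for which the initial segment up to `r`
carries at least a `√ε` fraction, and the final segment from `r` at least a `1-√ε` fraction, of
`∑ i, y_i tr A_i P`, and `lam = 2√ε / tr A_{σ r} P`. All choices of `σ` and `r` are allowed. -/
def StepLength {n m : ℕ} (ε : ℝ) (A : Fin m → Matrix (Fin n) (Fin n) ℂ)
    (Y : Matrix (Fin m) (Fin m) ℝ) (P : Matrix (Fin n) (Fin n) ℂ) (lam : ℝ) : Prop :=
  ∃ (σ : Equiv.Perm (Fin m)) (r : Fin m),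
    Antitone (fun q => (A (σ q) * P).trace.re) ∧
    √ε * ∑ q, Y (σ q) (σ q) * (A (σ q) * P).trace.re ≤
      ∑ q ∈ Finset.Iic r, Y (σ q) (σ q) * (A (σ q) * P).trace.re ∧
    (1 - √ε) * ∑ q, Y (σ q) (σ q) * (A (σ q) * P).trace.re ≤
      ∑ q ∈ Finset.Ici r, Y (σ q) (σ q) * (A (σ q) * P).trace.re ∧
    lam = 2 * √ε / (A (σ r) * P).trace.re

/-- One iteration of the main loop, from `s` to `s'`. It is performed with the phase value
`s'.k`. -/
def Iteration {n m : ℕ} (ε : ℝ) {A : Fin m → Matrix (Fin n) (Fin n) ℂ}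
    (hA : ∀ i, (A i).IsHermitian) (s s' : State n) : Prop :=
  ¬ Halted ε A s ∧
  PhaseUpdate ε A (dualVar A s.X) s.k s'.k ∧
  ∃ (thr : ℤ) (lam : ℝ),
    ThresholdSearch ε hA (dualVar A s.X) s'.k thr ∧
    StepLength ε A (dualVar A s.X)
      (eigProj (isHermitian_PhiStar hA (dualVar A s.X)) ((1 + eps0 n ε) ^ thr)) lam ∧
    s'.X = s.X + (lam : ℂ) •
      eigProj (isHermitian_PhiStar hA (dualVar A s.X)) ((1 + eps0 n ε) ^ thr)

/-- `s 0, …, s T` are the states of an execution of the algorithm that has performed `T`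
iterations (and that need not have stopped yet). -/
def IsExecution {n m : ℕ} (ε : ℝ) {A : Fin m → Matrix (Fin n) (Fin n) ℂ}
    (hA : ∀ i, (A i).IsHermitian) (T : ℕ) (s : ℕ → State n) : Prop :=
  IsInitial ε A (s 0) ∧ ∀ t < T, Iteration ε hA (s t) (s (t + 1))

/-- The number of those among the first `T` iterations that are performed with phase value
`k`. -/
def phaseCount {n : ℕ} (T : ℕ) (s : ℕ → State n) (k : ℤ) : ℕ :=
  {t ∈ Finset.range T | (s (t + 1)).k = k}.card

end PosSDP

end

/-! The proof follows the potential `excess B c` = tr (B − c)₊ of B = Φ*(Y_t), for a level c that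
stays fixed while t varies. As X grows in the Loewner order, Φ*(Y_t) decreases in it, so for every c
the potential never increases (`excess_mono`). This makes it possible to charge iterations that are
far apart in time to the same level.

An iteration with phase value k and threshold k − d is charged to c = (1+ε₀)^(k−d−1), one notch
below its cut θ = (1+ε₀)^(k−d). Let P be its projector, B' the new matrix, Q the spectral projector
of B' at c, and K = (1+ε₀)^k. The choice of step length makes tr BP drop by an ε fraction
(`StepLength.decrease`). This loss may be invisible to Q, because the eigenspaces may rotate. But tr
(B−B')P is at most 2 tr (B−B')Q + 4K tr (1−Q)P (`trace_mul_le_of_projection`), while the potential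
drops by at least tr (B−B')Q + (θ−c) tr (1−Q)P (`excess_sub_le`). So either kind of loss is paid
for, up to a factor of order ε₀. The failed threshold test gives N_c ≤ 2 N_θ, hence the potential
shrinks by the factor 1 − ε₀ε/48 (`excess_le_of_trace_decrease`).

At each charged iteration the potential lies between Kε₀/6 and 2nK, so each pair (k, d) is charged
O(log(n/ε₀)/(ε₀ε)) times (`card_le_of_geometric_decay`). Every successful test multiplies N by 1 +
2ε/5, and N has only a polynomial range in n, so d = O(log n/ε) (`steps_mul_log_le`). This bounds
each phase by O(log⁴n/ε⁵), which is stronger than required. The number of phases comes from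
comparing ‖Φ*(I)‖ ≤ m with a lower bound on ‖Φ*(Y_t)‖ that holds as long as the algorithm has not
stopped. -/

noncomputable section

namespace PosSDP

open Matrix Unitary

/-! ### Spectral projectors, and the potential tr (B − c)₊ under a Loewner decrease. -/

section Spectral

variable {n : ℕ} {B : Matrix (Fin n) (Fin n) ℂ}

/-- The `j`-th diagonal entry of `M` in an orthonormal eigenbasis of `B`. -/
def eigWeight (hB : B.IsHermitian) (M : Matrix (Fin n) (Fin n) ℂ) (j : Fin n) : ℝ :=
  ((star (hB.eigenvectorUnitary : Matrix (Fin n) (Fin n) ℂ) * M *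
    (hB.eigenvectorUnitary : Matrix (Fin n) (Fin n) ℂ)) j j).re

theorem trace_cfc_mul (hB : B.IsHermitian) (f : ℝ → ℝ) (M : Matrix (Fin n) (Fin n) ℂ) :
    (hB.cfc f * M).trace.re = ∑ j, f (hB.eigenvalues j) * eigWeight hB M j := by
  rw [IsHermitian.cfc, conjStarAlgAut_apply, mul_assoc, mul_assoc, trace_mul_comm, mul_assoc,
    trace, Complex.re_sum]
  refine Finset.sum_congr rfl fun j _ => ?_
  simp [eigWeight, diagonal_mul, mul_assoc]

theorem cfc_id_eq (hB : B.IsHermitian) : hB.cfc (fun x => x) = B :=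
  hB.spectral_theorem.symm

theorem cfc_one_eq (hB : B.IsHermitian) : hB.cfc (fun _ => 1) = 1 := by
  have : (RCLike.ofReal ∘ (fun _ : ℝ => (1 : ℝ)) ∘ hB.eigenvalues : Fin n → ℂ) = 1 := by
    ext; simp
  rw [IsHermitian.cfc, this]
  simp

theorem cfc_mul_cfc (hB : B.IsHermitian) (f g : ℝ → ℝ) :
    hB.cfc f * hB.cfc g = hB.cfc (fun x => f x * g x) := by
  rw [IsHermitian.cfc, IsHermitian.cfc, IsHermitian.cfc, ← map_mul, diagonal_mul_diagonal]
  congr 2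
  ext; simp

theorem cfc_sub_cfc (hB : B.IsHermitian) (f g : ℝ → ℝ) :
    hB.cfc f - hB.cfc g = hB.cfc (fun x => f x - g x) := by
  rw [IsHermitian.cfc, IsHermitian.cfc, IsHermitian.cfc, ← map_sub, diagonal_sub]
  congr 2
  ext; simp

theorem posSemidef_cfc (hB : B.IsHermitian) {f : ℝ → ℝ} (hf : ∀ j, 0 ≤ f (hB.eigenvalues j)) :
    (hB.cfc f).PosSemidef := by
  rw [IsHermitian.cfc, conjStarAlgAut_apply]
  refine PosSemidef.mul_mul_conjTranspose_same (PosSemidef.diagonal fun j => ?_) _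
  simpa using hf j

theorem eigWeight_nonneg (hB : B.IsHermitian) {M : Matrix (Fin n) (Fin n) ℂ}
    (hM : M.PosSemidef) (j : Fin n) : 0 ≤ eigWeight hB M j := by
  have := (hM.conjTranspose_mul_mul_same
    (hB.eigenvectorUnitary : Matrix (Fin n) (Fin n) ℂ)).diag_nonneg (i := j)
  exact (Complex.le_def.1 this).1

theorem eigWeight_sub (hB : B.IsHermitian) (M N : Matrix (Fin n) (Fin n) ℂ) (j : Fin n) :
    eigWeight hB (M - N) j = eigWeight hB M j - eigWeight hB N j := by
  simp [eigWeight, mul_sub, sub_mul]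

theorem eigWeight_one (hB : B.IsHermitian) (j : Fin n) : eigWeight hB 1 j = 1 := by
  simp [eigWeight]

theorem trace_mul_nonneg {M N : Matrix (Fin n) (Fin n) ℂ} (hM : M.PosSemidef)
    (hN : N.PosSemidef) : 0 ≤ (M * N).trace.re := by
  conv_rhs => rw [← cfc_id_eq hM.isHermitian]
  rw [trace_cfc_mul]
  exact Finset.sum_nonneg fun j _ =>
    mul_nonneg (hM.eigenvalues_nonneg j) (eigWeight_nonneg _ hN j)

theorem posSemidef_eigProj (hB : B.IsHermitian) (l : ℝ) : (eigProj hB l).PosSemidef :=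
  posSemidef_cfc hB fun j => by split_ifs <;> norm_num

theorem eigProj_mul_self (hB : B.IsHermitian) (l : ℝ) :
    eigProj hB l * eigProj hB l = eigProj hB l := by
  rw [eigProj, cfc_mul_cfc]
  congr 1
  ext x
  split_ifs <;> norm_num

theorem posSemidef_one_sub_eigProj (hB : B.IsHermitian) (l : ℝ) :
    (1 - eigProj hB l).PosSemidef := by
  rw [← cfc_one_eq hB, eigProj, cfc_sub_cfc]
  exact posSemidef_cfc hB fun j => by split_ifs <;> norm_num

theorem trace_eigProj_mul (hB : B.IsHermitian) (l : ℝ) (M : Matrix (Fin n) (Fin n) ℂ) :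
    (eigProj hB l * M).trace.re = ∑ j with l ≤ hB.eigenvalues j, eigWeight hB M j := by
  rw [eigProj, trace_cfc_mul, Finset.sum_filter]
  exact Finset.sum_congr rfl fun j _ => by split_ifs <;> simp

theorem eigSum_eq_trace (hB : B.IsHermitian) (l : ℝ) :
    eigSum hB l = (B * eigProj hB l).trace.re := by
  have h : B * eigProj hB l = hB.cfc (fun x => if l ≤ x then x else 0) * 1 := by
    conv_lhs => arg 1; rw [← cfc_id_eq hB]
    rw [eigProj, cfc_mul_cfc, mul_one]
    simp
  rw [h, trace_cfc_mul, eigSum, Finset.sum_filter]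
  exact Finset.sum_congr rfl fun j _ => by simp [eigWeight_one]

/-- `tr (B - c)₊`. -/
def excess (hB : B.IsHermitian) (c : ℝ) : ℝ := ∑ j, max (hB.eigenvalues j - c) 0

theorem excess_eq_trace (hB : B.IsHermitian) (c : ℝ) :
    excess hB c = (B * eigProj hB c).trace.re - c * (eigProj hB c).trace.re := by
  have h := trace_eigProj_mul hB c 1
  rw [mul_one] at h
  rw [← eigSum_eq_trace, h, eigSum, Finset.mul_sum, ← Finset.sum_sub_distrib, Finset.sum_filter,
    excess]
  refine Finset.sum_congr rfl fun j _ => ?_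
  rw [eigWeight_one]
  split_ifs with hj
  · rw [max_eq_left (by linarith)]; ring
  · rw [max_eq_right (by linarith)]

/-- In an eigenbasis of B, the operator Q has diagonal weights w in [0, 1], and w(λ − c) ≤ (λ − c)₊.
When λ ≥ θ the missing weight 1 − w gives slack (1 − w)(λ − c) ≥ (1 − w)(θ − c); these slacks add up
to the last term. -/
theorem trace_mul_add_le_excess (hB : B.IsHermitian) {Q : Matrix (Fin n) (Fin n) ℂ}
    (hQ : Q.PosSemidef) (hQ1 : (1 - Q).PosSemidef) (c θ : ℝ) :
    (B * Q).trace.re - c * Q.trace.re + (θ - c) * ((1 - Q) * eigProj hB θ).trace.re ≤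
      excess hB c := by
  have h1 : (B * Q).trace.re = ∑ j, hB.eigenvalues j * eigWeight hB Q j := by
    rw [← trace_cfc_mul hB (fun x => x), cfc_id_eq]
  have h2 : Q.trace.re = ∑ j, eigWeight hB Q j := by
    have := trace_cfc_mul hB (fun _ => 1) Q
    rw [cfc_one_eq, one_mul] at this
    simpa using this
  rw [trace_mul_comm (1 - Q), trace_eigProj_mul, Finset.sum_filter, h1, h2, Finset.mul_sum,
    Finset.mul_sum, ← Finset.sum_sub_distrib, ← Finset.sum_add_distrib, excess]
  refine Finset.sum_le_sum fun j _ => ?_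
  have w0 := eigWeight_nonneg hB hQ j
  have w1 := eigWeight_nonneg hB hQ1 j
  rw [eigWeight_sub, eigWeight_one] at *
  have m1 := le_max_left (hB.eigenvalues j - c) 0
  have m2 := le_max_right (hB.eigenvalues j - c) 0
  split_ifs with hj
  · nlinarith
  · nlinarith

/-- With R = 1 − Q, positivity of (Q − R)M(Q − R) gives M ≤ 2QMQ + 2RMR, a substitute for dropping
the off-diagonal blocks. Then P ≤ 1 is used on the first block and M ≤ K on the second. -/
theorem trace_mul_le_of_projection {M Q P : Matrix (Fin n) (Fin n) ℂ} {K : ℝ}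
    (hM : M.PosSemidef) (hMK : ((K : ℂ) • (1 : Matrix (Fin n) (Fin n) ℂ) - M).PosSemidef)
    (hQ : Q.IsHermitian) (hQQ : Q * Q = Q) (hP : P.PosSemidef) (hP1 : (1 - P).PosSemidef) :
    (M * P).trace.re ≤ 2 * (M * Q).trace.re + 2 * K * ((1 - Q) * P).trace.re := by
  have hR : (1 - Q).IsHermitian := isHermitian_one.sub hQ
  have a1 := trace_mul_nonneg (hM.conjTranspose_mul_mul_same (2 • Q - 1)) hP
  have a2 := trace_mul_nonneg (hM.conjTranspose_mul_mul_same Q) hP1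
  have a3 := trace_mul_nonneg (hMK.conjTranspose_mul_mul_same (1 - Q)) hP
  have hS : (2 • Q - 1).IsHermitian := by
    rw [two_smul]; exact (hQ.add hQ).sub isHermitian_one
  rw [hS.eq] at a1
  rw [hQ.eq] at a2
  rw [hR.eq] at a3
  have e2 : (Q * M * Q).trace.re = (M * Q).trace.re := by
    rw [trace_mul_comm, ← mul_assoc, hQQ, trace_mul_comm]
  have e3 : (1 - Q) * ((K : ℂ) • (1 : Matrix (Fin n) (Fin n) ℂ) - M) * (1 - Q)
      = (K : ℂ) • (1 - Q) - (1 - Q) * M * (1 - Q) := by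
    have : (1 - Q) * (1 - Q) = 1 - Q := by
      simp only [mul_sub, sub_mul, hQQ, mul_one, one_mul]; abel
    rw [mul_sub (1 - Q), sub_mul _ _ (1 - Q), mul_smul_comm, mul_one, smul_mul_assoc, this]
  have e1 : (2 • Q - 1) * M * (2 • Q - 1) * P
      = 2 • (Q * M * Q * P) + 2 • ((1 - Q) * M * (1 - Q) * P) - M * P := by
    noncomm_ring
  rw [e3, sub_mul, trace_sub, smul_mul_assoc, trace_smul] at a3
  rw [e1, trace_sub, trace_add, trace_smul, trace_smul] at a1
  rw [mul_sub, mul_one, trace_sub] at a2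
  simp at a1 a2 a3
  nlinarith

/-- The excess of `B` over `c` decreases in the Loewner order, quantitatively. -/
theorem excess_sub_le (hB : B.IsHermitian) {B' : Matrix (Fin n) (Fin n) ℂ}
    (hB' : B'.IsHermitian) (c θ : ℝ) :
    excess hB' c + ((B - B') * eigProj hB' c).trace.re +
      (θ - c) * ((1 - eigProj hB' c) * eigProj hB θ).trace.re ≤ excess hB c := by
  -- The projector of B' at c attains the excess of B', so as a trial operator for B it compares the
  -- two excesses.
  have := trace_mul_add_le_excess hB (posSemidef_eigProj hB' c)
    (posSemidef_one_sub_eigProj hB' c) c θ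
  rw [excess_eq_trace hB', sub_mul, trace_sub, Complex.sub_re]
  linarith

theorem excess_mono (hB : B.IsHermitian) {B' : Matrix (Fin n) (Fin n) ℂ}
    (hB' : B'.IsHermitian) (h : (B - B').PosSemidef) (c : ℝ) : excess hB' c ≤ excess hB c := by
  -- With θ = c the rotation term vanishes.
  have h1 := excess_sub_le hB hB' c c
  have h2 := trace_mul_nonneg h (posSemidef_eigProj hB' c)
  linarith

end Spectral

/-! ### Spectral norm and eigenvalues. -/

section Norm

variable {n : ℕ} {B : Matrix (Fin n) (Fin n) ℂ}

open scoped Matrix.Norms.L2Operator MatrixOrder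

theorem opNorm_eq_norm (M : Matrix (Fin n) (Fin n) ℂ) : opNorm M = ‖M‖ := rfl

theorem opNorm_lt_iff (hB : B.PosSemidef) {c : ℝ} (hc : 0 < c) :
    opNorm B < c ↔ ∀ j, hB.isHermitian.eigenvalues j < c := by
  have h : opNorm B = ‖(RCLike.ofReal ∘ hB.isHermitian.eigenvalues : Fin n → ℂ)‖ := by
    rw [← l2_opNorm_diagonal, opNorm_eq_norm]
    conv_lhs => rw [hB.isHermitian.spectral_theorem, conjStarAlgAut_apply]
    rw [CStarRing.norm_mul_mem_unitary _ (by simp), CStarRing.norm_mem_unitary_mul _ (by simp)]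
  rw [h, pi_norm_lt_iff hc]
  refine forall_congr' fun j => ?_
  simp [abs_of_nonneg (hB.eigenvalues_nonneg j)]

theorem opNorm_mono {B' : Matrix (Fin n) (Fin n) ℂ} (hB' : B'.PosSemidef)
    (h : (B - B').PosSemidef) : opNorm B' ≤ opNorm B := by
  rw [opNorm_eq_norm, opNorm_eq_norm]
  exact CStarAlgebra.norm_le_norm_of_nonneg_of_le hB'.nonneg (Matrix.le_iff.2 h)

theorem opNorm_smul (c : ℝ) (M : Matrix (Fin n) (Fin n) ℂ) :
    opNorm ((c : ℂ) • M) = |c| * opNorm M := by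
  simp [opNorm_eq_norm, norm_smul]

theorem opNorm_sum_le {m : ℕ} (A : Fin m → Matrix (Fin n) (Fin n) ℂ) :
    opNorm (∑ i, A i) ≤ ∑ i, opNorm (A i) := by
  simp only [opNorm_eq_norm]
  exact norm_sum_le _ _

theorem posSemidef_smul_one_sub (hB : B.IsHermitian) {K : ℝ}
    (hK : ∀ j, hB.eigenvalues j ≤ K) :
    ((K : ℂ) • (1 : Matrix (Fin n) (Fin n) ℂ) - B).PosSemidef := by
  have : (K : ℂ) • (1 : Matrix (Fin n) (Fin n) ℂ) = hB.cfc (fun _ => K) := by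
    have : (RCLike.ofReal ∘ (fun _ : ℝ => (K : ℝ)) ∘ hB.eigenvalues : Fin n → ℂ) =
        fun _ => (K : ℂ) := by ext; simp
    rw [IsHermitian.cfc, this, ← smul_one_eq_diagonal]
    simp
  rw [this]
  conv => arg 1; arg 2; rw [← cfc_id_eq hB]
  rw [cfc_sub_cfc]
  exact posSemidef_cfc hB fun j => by linarith [hK j]

end Norm

/-! ### Bounds on eigenvalue sums and on the excess in terms of the norm. -/

section EigSum

variable {n : ℕ} {B : Matrix (Fin n) (Fin n) ℂ}

theorem exists_le_eigenvalue (hB : B.PosSemidef) {c : ℝ} (hc : 0 < c) (h : c ≤ opNorm B) :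
    ∃ j, c ≤ hB.isHermitian.eigenvalues j := by
  by_contra! hj
  exact absurd ((opNorm_lt_iff hB hc).2 hj) (not_lt.2 h)

theorem le_eigSum (hB : B.PosSemidef) {c l : ℝ} (hc : 0 < c) (h : c ≤ opNorm B) (hl : l ≤ c) :
    c ≤ eigSum hB.isHermitian l := by
  obtain ⟨j, hj⟩ := exists_le_eigenvalue hB hc h
  refine hj.trans (Finset.single_le_sum (f := hB.isHermitian.eigenvalues)
    (fun i _ => hB.eigenvalues_nonneg i) ?_)
  simpa using hl.trans hj

theorem eigSum_le (hB : B.PosSemidef) {K : ℝ} (hK : 0 < K) (h : opNorm B < K) (l : ℝ) :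
    eigSum hB.isHermitian l ≤ n * K := by
  have hlt := (opNorm_lt_iff hB hK).1 h
  calc eigSum hB.isHermitian l ≤ ∑ j, hB.isHermitian.eigenvalues j :=
        Finset.sum_le_sum_of_subset_of_nonneg (Finset.filter_subset _ _)
          fun i _ _ => hB.eigenvalues_nonneg i
    _ ≤ ∑ _j : Fin n, K := Finset.sum_le_sum fun j _ => (hlt j).le
    _ = n * K := by simp

theorem excess_le_eigSum (hB : B.PosSemidef) {c : ℝ} (hc : 0 ≤ c) :
    excess hB.isHermitian c ≤ eigSum hB.isHermitian c := by
  rw [excess, eigSum, Finset.sum_filter]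
  refine Finset.sum_le_sum fun j _ => ?_
  split_ifs with hj
  · exact max_le (by linarith) (hB.eigenvalues_nonneg j)
  · exact max_le (by linarith) le_rfl

theorem sub_le_excess (hB : B.PosSemidef) {K : ℝ} (hK : 0 < K) (h : K ≤ opNorm B) (c : ℝ) :
    K - c ≤ excess hB.isHermitian c := by
  obtain ⟨j, hj⟩ := exists_le_eigenvalue hB hK h
  calc K - c ≤ max (hB.isHermitian.eigenvalues j - c) 0 := le_max_of_le_left (by linarith)
    _ ≤ _ := Finset.single_le_sum (f := fun j => max (hB.isHermitian.eigenvalues j - c) 0)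
        (fun i _ => le_max_right _ _) (Finset.mem_univ j)

end EigSum

/-! ### The dual variable and the step length. -/

section Dual

variable {n m : ℕ} {A : Fin m → Matrix (Fin n) (Fin n) ℂ}

theorem dualVar_eq (A : Fin m → Matrix (Fin n) (Fin n) ℂ) (X : Matrix (Fin n) (Fin n) ℂ) :
    dualVar A X = diagonal fun i => Real.exp (-(A i * X).trace.re) := by
  rw [dualVar, Phi, diagonal_neg, exp_diagonal]
  congr 1
  ext i
  rw [Pi.coe_exp, Real.exp_eq_exp_ℝ]

theorem dualVar_apply (A : Fin m → Matrix (Fin n) (Fin n) ℂ) (X : Matrix (Fin n) (Fin n) ℂ)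
    (i : Fin m) : dualVar A X i i = Real.exp (-(A i * X).trace.re) := by
  rw [dualVar_eq, diagonal_apply_eq]

theorem dualVar_zero (A : Fin m → Matrix (Fin n) (Fin n) ℂ) : dualVar A 0 = 1 := by
  simp [dualVar_eq]

theorem PhiStar_sub (Y Y' : Matrix (Fin m) (Fin m) ℝ) :
    PhiStar A Y - PhiStar A Y' = PhiStar A (Y - Y') := by
  simp [PhiStar, ← Finset.sum_sub_distrib, sub_smul]

theorem posSemidef_PhiStar (hA : ∀ i, (A i).PosSemidef) {Y : Matrix (Fin m) (Fin m) ℝ}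
    (hY : ∀ i, 0 ≤ Y i i) : (PhiStar A Y).PosSemidef :=
  posSemidef_sum _ fun i _ => (hA i).smul (by exact_mod_cast hY i)

theorem trace_PhiStar_mul (Y : Matrix (Fin m) (Fin m) ℝ) (P : Matrix (Fin n) (Fin n) ℂ) :
    (PhiStar A Y * P).trace.re = ∑ i, Y i i * (A i * P).trace.re := by
  simp [PhiStar, Finset.sum_mul, trace_sum]

theorem mul_opNorm_le (hA : ∀ i, (A i).PosSemidef) {Y : Matrix (Fin m) (Fin m) ℝ}
    (hY : ∀ i, 0 ≤ Y i i) (i : Fin m) : Y i i * opNorm (A i) ≤ opNorm (PhiStar A Y) := by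
  have h1 : opNorm (((Y i i : ℝ) : ℂ) • A i) = Y i i * opNorm (A i) := by
    rw [opNorm_smul, abs_of_nonneg (hY i)]
  rw [← h1]
  refine opNorm_mono ((hA i).smul (by exact_mod_cast hY i)) ?_
  rw [PhiStar, ← Finset.sum_erase_add _ _ (Finset.mem_univ i), add_sub_cancel_right]
  exact posSemidef_sum _ fun i _ => (hA i).smul (by exact_mod_cast hY i)

theorem one_sub_exp_neg_ge {x : ℝ} (h0 : 0 ≤ x) (h1 : x ≤ 1) : x / 2 ≤ 1 - Real.exp (-x) := by
  have h := Real.add_one_le_exp x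
  have h2 : Real.exp (-x) ≤ (1 + x)⁻¹ := by
    rw [Real.exp_neg]
    exact inv_anti₀ (by linarith) (by linarith)
  have h3 : (1 + x)⁻¹ ≤ 1 - x / 2 := by
    rw [inv_le_iff_one_le_mul₀ (by linarith)]
    nlinarith
  linarith

/-- Each index up to r has λ tr A_iP ≥ 2√ε, so its y_i loses at least a √ε fraction. These indices
carry a √ε fraction of the sum, and the two factors multiply to ε. -/
theorem StepLength.decrease {ε lam : ℝ} {Y : Matrix (Fin m) (Fin m) ℝ}
    {P : Matrix (Fin n) (Fin n) ℂ} (h : StepLength ε A Y P lam) (hε : 0 < ε) (hε' : ε ≤ 1 / 4)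
    (ha : ∀ i, 0 ≤ (A i * P).trace.re) (hY : ∀ i, 0 ≤ Y i i)
    (hS : 0 < ∑ i, Y i i * (A i * P).trace.re) :
    0 ≤ lam ∧ ε * ∑ i, Y i i * (A i * P).trace.re ≤
      ∑ i, Y i i * (1 - Real.exp (-(lam * (A i * P).trace.re))) * (A i * P).trace.re := by
  obtain ⟨σ, r, hσ, h1, h2, rfl⟩ := h
  set a : Fin m → ℝ := fun i => (A i * P).trace.re with ha_def
  have hs0 : 0 < √ε := Real.sqrt_pos.2 hε
  have hsq : √ε * √ε = ε := Real.mul_self_sqrt hε.le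
  have hs1 : √ε ≤ 1 / 2 := by nlinarith
  rw [Equiv.sum_comp σ (fun i => Y i i * a i)] at h1 h2
  -- If tr A_{σ r}P were 0, so would be all later traces, and the final segment could not carry a
  -- positive share. Hence λ is not a division by zero.
  have hr : 0 < a (σ r) := by
    refine lt_of_le_of_ne (ha _) fun h0 => ?_
    have : ∑ q ∈ Finset.Ici r, Y (σ q) (σ q) * a (σ q) ≤ 0 :=
      Finset.sum_nonpos fun q hq => by
        have := hσ (Finset.mem_Ici.1 hq)
        have h3 : a (σ q) ≤ a (σ r) := this
        nlinarith [hY (σ q)]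
    have : 0 < (1 - √ε) * ∑ i, Y i i * a i := mul_pos (by linarith) hS
    linarith
  have hlam : 0 ≤ 2 * √ε / a (σ r) := by positivity
  refine ⟨hlam, ?_⟩
  have hnn : ∀ i, 0 ≤ Y i i * (1 - Real.exp (-(2 * √ε / a (σ r) * a i))) * a i := fun i => by
    have : Real.exp (-(2 * √ε / a (σ r) * a i)) ≤ 1 :=
      Real.exp_le_one_iff.2 (by have := mul_nonneg hlam (ha i); linarith)
    exact mul_nonneg (mul_nonneg (hY i) (by linarith)) (ha i)
  calc ε * ∑ i, Y i i * a i = √ε * (√ε * ∑ i, Y i i * a i) := by rw [← mul_assoc, hsq]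
    _ ≤ √ε * ∑ q ∈ Finset.Iic r, Y (σ q) (σ q) * a (σ q) := by gcongr
    _ = ∑ q ∈ Finset.Iic r, √ε * (Y (σ q) (σ q) * a (σ q)) := Finset.mul_sum _ _ _
    _ ≤ ∑ q ∈ Finset.Iic r,
        Y (σ q) (σ q) * (1 - Real.exp (-(2 * √ε / a (σ r) * a (σ q)))) * a (σ q) := by
      refine Finset.sum_le_sum fun q hq => ?_
      have h3 : a (σ r) ≤ a (σ q) := hσ (Finset.mem_Iic.1 hq)
      have h4 : 2 * √ε ≤ 2 * √ε / a (σ r) * a (σ q) := by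
        rw [div_mul_eq_mul_div, le_div_iff₀ hr]; gcongr
      have h5 := one_sub_exp_neg_ge (x := 2 * √ε) (by linarith) (by linarith)
      have h6 : Real.exp (-(2 * √ε / a (σ r) * a (σ q))) ≤ Real.exp (-(2 * √ε)) :=
        Real.exp_le_exp.2 (by linarith)
      have h7 : 0 ≤ Y (σ q) (σ q) * a (σ q) := mul_nonneg (hY _) (ha _)
      calc √ε * (Y (σ q) (σ q) * a (σ q))
          ≤ (1 - Real.exp (-(2 * √ε / a (σ r) * a (σ q)))) * (Y (σ q) (σ q) * a (σ q)) :=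
            mul_le_mul_of_nonneg_right (by linarith) h7
        _ = _ := by ring
    _ ≤ ∑ q, Y (σ q) (σ q) * (1 - Real.exp (-(2 * √ε / a (σ r) * a (σ q)))) * a (σ q) :=
      Finset.sum_le_sum_of_subset_of_nonneg (Finset.subset_univ _) fun q _ _ => hnn (σ q)
    _ = _ := Equiv.sum_comp σ fun i => Y i i * (1 - Real.exp (-(2 * √ε / a (σ r) * a i))) * a i

/-- The first r whose initial segment reaches the √ε fraction works: the segment strictly before it
falls short, so the rest from r on has at least 1 − √ε. -/
theorem exists_stepLength {ε : ℝ} (Y : Matrix (Fin m) (Fin m) ℝ) (P : Matrix (Fin n) (Fin n) ℂ)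
    (hm : 1 ≤ m) (hε' : ε ≤ 1) (hS : 0 ≤ ∑ i, Y i i * (A i * P).trace.re) :
    ∃ lam, StepLength ε A Y P lam := by
  set σ := Tuple.sort fun i => -(A i * P).trace.re with hσ
  have hanti : Antitone (fun q => (A (σ q) * P).trace.re) := fun p q hpq => by
    have := Tuple.monotone_sort (fun i => -(A i * P).trace.re) hpq
    simpa using this
  have hs1 : √ε ≤ 1 := by simpa using Real.sqrt_le_sqrt hε'
  set g : Fin m → ℝ := fun q => Y (σ q) (σ q) * (A (σ q) * P).trace.re with hg
  have hgS : 0 ≤ ∑ q, g q := by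
    rw [hg, Equiv.sum_comp σ fun i => Y i i * (A i * P).trace.re]; exact hS
  have hex : ∃ r : Fin m, √ε * ∑ q, g q ≤ ∑ q ∈ Finset.Iic r, g q := by
    have : NeZero m := ⟨by omega⟩
    refine ⟨⊤, ?_⟩
    rw [Finset.Iic_top]
    exact mul_le_of_le_one_left hgS hs1
  obtain ⟨r, hr, hmin⟩ := WellFounded.has_min (wellFounded_lt (α := Fin m)) _ hex
  refine ⟨_, σ, r, hanti, hr, ?_, rfl⟩
  change (1 - √ε) * ∑ q, g q ≤ ∑ q ∈ Finset.Ici r, g q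
  have hsplit : ∑ q, g q = ∑ q ∈ Finset.Iio r, g q + ∑ q ∈ Finset.Ici r, g q := by
    rw [← Finset.sum_filter_add_sum_filter_not Finset.univ (· < r)]
    congr 2 <;> ext <;> simp
  have hpre : ∑ q ∈ Finset.Iio r, g q ≤ √ε * ∑ q, g q := by
    by_cases h0 : r.val = 0
    · have : Finset.Iio r = ∅ := by
        ext q; simp [Fin.lt_def, h0]
      rw [this, Finset.sum_empty]
      exact mul_nonneg (Real.sqrt_nonneg _) hgS
    · have : Finset.Iio r = Finset.Iic ⟨r.val - 1, by omega⟩ := by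
        ext q; simp only [Finset.mem_Iio, Finset.mem_Iic, Fin.lt_def, Fin.le_def]; omega
      rw [this]
      exact (not_le.1 fun h => hmin ⟨r.val - 1, by omega⟩ h
        (by simp only [Fin.lt_def]; omega)).le
  linarith

end Dual

/-! ### Termination of the phase update and of the threshold search. -/

section Search

variable {n m : ℕ} {A : Fin m → Matrix (Fin n) (Fin n) ℂ} {ε : ℝ}

theorem exists_phaseUpdate {Y : Matrix (Fin m) (Fin m) ℝ} (hq : 0 < eps0 n ε)
    (h : 0 < opNorm (PhiStar A Y)) (k : ℤ) : ∃ k', PhaseUpdate ε A Y k k' := by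
  obtain ⟨j, hj1, hj2⟩ := exists_mem_Ico_zpow h (show 1 < 1 + eps0 n ε by linarith)
  refine ⟨min k j, min_le_left _ _, fun i hi hik => ?_, ?_⟩
  · refine hj2.trans_le (zpow_le_zpow_right₀ (by linarith) ?_)
    rcases min_lt_iff.1 hi with h | h <;> omega
  · exact not_lt.2 ((zpow_le_zpow_right₀ (by linarith) (min_le_right _ _)).trans hj1)

/-- Preserves the upper half of the bracket around the norm: if k was lowered, the last successful
test was at k' + 1. -/
theorem PhaseUpdate.opNorm_lt {Y : Matrix (Fin m) (Fin m) ℝ} {k k' : ℤ}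
    (h : PhaseUpdate ε A Y k k') (hk : opNorm (PhiStar A Y) < (1 + eps0 n ε) ^ (k + 1)) :
    opNorm (PhiStar A Y) < (1 + eps0 n ε) ^ (k' + 1) := by
  rcases h.1.lt_or_eq with hlt | rfl
  · exact h.2.1 _ (by omega) (by omega)
  · exact hk

theorem pow_mul_eigSum_le {hA : ∀ i, (A i).IsHermitian} {Y : Matrix (Fin m) (Fin m) ℝ}
    (hε : 0 < ε) {k : ℤ} (d : ℕ) (h : ∀ s : ℤ, k - d < s → s ≤ k → ThrTest ε hA Y s) :
    (1 + 2 / 5 * ε) ^ d * eigSum (isHermitian_PhiStar hA Y) ((1 + eps0 n ε) ^ k) ≤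
      eigSum (isHermitian_PhiStar hA Y) ((1 + eps0 n ε) ^ (k - d)) := by
  induction d with
  | zero => simp
  | succ d ih =>
    have h1 := ih fun s hs hsk => h s (by push_cast; omega) hsk
    have h2 : ThrTest ε hA Y (k - d) := h _ (by push_cast; omega) (by omega)
    rw [ThrTest] at h2
    rw [show k - ((d + 1 : ℕ) : ℤ) = k - d - 1 by push_cast; ring, pow_succ', mul_assoc]
    exact (mul_le_mul_of_nonneg_left h1 (by linarith)).trans h2

/-- N starts at K = (1+ε₀)^k or more, since some eigenvalue reaches K, and never exceeds nK(1+ε₀) ≤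
n²K. Hence (1+2ε/5)^d ≤ n², and log(1+2ε/5) ≥ ε/5 gives the constant 10. -/
theorem steps_mul_log_le (hA : ∀ i, (A i).PosSemidef) {Y : Matrix (Fin m) (Fin m) ℝ}
    (hY : ∀ i, 0 ≤ Y i i) (hε : 0 < ε) (hq : 0 < eps0 n ε) (hq1 : eps0 n ε ≤ 1)
    (hε1 : ε ≤ 1) {k : ℤ}
    (hlo : (1 + eps0 n ε) ^ k ≤ opNorm (PhiStar A Y))
    (hhi : opNorm (PhiStar A Y) < (1 + eps0 n ε) ^ (k + 1)) (hn : 3 ≤ n) (d : ℕ)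
    (h : ∀ s : ℤ, k - d < s → s ≤ k → ThrTest ε (fun i => (hA i).isHermitian) Y s) :
    (d : ℝ) ≤ 10 * Real.log n / ε := by
  have hB := posSemidef_PhiStar hA hY
  have hK : 0 < (1 + eps0 n ε) ^ k := by positivity
  have h1 := pow_mul_eigSum_le hε d h
  have h2 := le_eigSum hB hK hlo le_rfl
  have h3 := eigSum_le hB (by positivity) hhi ((1 + eps0 n ε) ^ (k - d))
  rw [zpow_add₀ (by positivity), zpow_one] at h3
  have hn' : (3 : ℝ) ≤ n := by exact_mod_cast hn
  have h4 : (1 + 2 / 5 * ε) ^ d * (1 + eps0 n ε) ^ k ≤ (n : ℝ) ^ 2 * (1 + eps0 n ε) ^ k :=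
    calc (1 + 2 / 5 * ε) ^ d * (1 + eps0 n ε) ^ k
        ≤ n * ((1 + eps0 n ε) ^ k * (1 + eps0 n ε)) :=
          (mul_le_mul_of_nonneg_left h2 (by positivity)).trans (h1.trans h3)
      _ = (n * (1 + eps0 n ε)) * (1 + eps0 n ε) ^ k := by ring
      _ ≤ (n : ℝ) ^ 2 * (1 + eps0 n ε) ^ k := by
          refine mul_le_mul_of_nonneg_right ?_ hK.le
          nlinarith
  have h5 := Real.log_le_log (by positivity) (le_of_mul_le_mul_right h4 hK)
  rw [Real.log_pow, Real.log_pow] at h5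
  have h6 := Real.one_sub_inv_le_log_of_pos (show 0 < 1 + 2 / 5 * ε by linarith)
  have h7 : ε / 5 ≤ 1 - (1 + 2 / 5 * ε)⁻¹ := by
    have : (1 + 2 / 5 * ε)⁻¹ ≤ 1 - ε / 5 := by
      rw [inv_le_iff_one_le_mul₀ (by linarith)]
      nlinarith
    linarith
  rw [le_div_iff₀ hε]
  have : (d : ℝ) * (ε / 5) ≤ d * Real.log (1 + 2 / 5 * ε) :=
    mul_le_mul_of_nonneg_left (h7.trans h6) d.cast_nonneg
  push_cast at h5
  linarith

theorem exists_thresholdSearch (hA : ∀ i, (A i).PosSemidef) {Y : Matrix (Fin m) (Fin m) ℝ}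
    (hY : ∀ i, 0 ≤ Y i i) (hε : 0 < ε) (hq : 0 < eps0 n ε) (hq1 : eps0 n ε ≤ 1)
    (hε1 : ε ≤ 1) {k : ℤ}
    (hlo : (1 + eps0 n ε) ^ k ≤ opNorm (PhiStar A Y))
    (hhi : opNorm (PhiStar A Y) < (1 + eps0 n ε) ^ (k + 1)) (hn : 3 ≤ n) :
    ∃ thr, ThresholdSearch ε (fun i => (hA i).isHermitian) Y k thr := by
  classical
  have hex : ∃ d : ℕ, ¬ ThrTest ε (fun i => (hA i).isHermitian) Y (k - d) := by
    by_contra! hall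
    obtain ⟨N, hN⟩ := exists_nat_gt (10 * Real.log n / ε)
    refine absurd (steps_mul_log_le hA hY hε hq hq1 hε1 hlo hhi hn N fun s _ hs => ?_)
      (not_le.2 hN)
    have := hall (k - s).toNat
    rwa [Int.toNat_of_nonneg (by omega), sub_sub_cancel] at this
  refine ⟨k - Nat.find hex, by omega, fun s hs hsk => ?_, Nat.find_spec hex⟩
  have := Nat.find_min hex (m := (k - s).toNat) (by omega)
  rwa [not_not, Int.toNat_of_nonneg (by omega), sub_sub_cancel] at this

end Search

/-! ### One iteration: geometric decrease of the excess. -/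

section Step

variable {n m : ℕ} {A : Fin m → Matrix (Fin n) (Fin n) ℂ} {ε : ℝ}

theorem one_le_log {n : ℕ} (hn : 3 ≤ n) : 1 ≤ Real.log n := by
  have hn' : (3 : ℝ) ≤ n := by exact_mod_cast hn
  rw [Real.le_log_iff_exp_le (by linarith)]
  linarith [Real.exp_one_lt_three]

theorem eps0_pos {n : ℕ} (hn : 3 ≤ n) (hε : 0 < ε) : 0 < eps0 n ε := by
  have := one_le_log hn
  rw [eps0]; positivity

theorem eps0_le {n : ℕ} (hn : 3 ≤ n) : eps0 n ε ≤ ε ^ 2 := by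
  have := one_le_log hn
  exact div_le_self (sq_nonneg _) (one_le_pow₀ this)

theorem dualVar_nonneg (X : Matrix (Fin n) (Fin n) ℂ) (i : Fin m) : 0 ≤ dualVar A X i i := by
  rw [dualVar_apply]; positivity

theorem dualVar_add_smul (X P : Matrix (Fin n) (Fin n) ℂ) (lam : ℝ) (i : Fin m) :
    dualVar A (X + (lam : ℂ) • P) i i =
      dualVar A X i i * Real.exp (-(lam * (A i * P).trace.re)) := by
  rw [dualVar_apply, dualVar_apply, ← Real.exp_add]
  congr 1
  simp [mul_add]
  ring

/-- The threshold stays within a constant factor of the phase level, because d·ε₀ ≤ 10ε/ln n ≤ 1. -/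
theorem pow_le_three {n d : ℕ} (hn : 3 ≤ n) (hε : 0 < ε) (hε' : ε ≤ 1 / 10)
    (hd : (d : ℝ) ≤ 10 * Real.log n / ε) : (1 + eps0 n ε) ^ d ≤ 3 := by
  have hL := one_le_log hn
  have hq := eps0_pos hn hε
  calc (1 + eps0 n ε) ^ d ≤ Real.exp (eps0 n ε) ^ d := by
        refine pow_le_pow_left₀ (by linarith) ?_ d
        linarith [Real.add_one_le_exp (eps0 n ε)]
    _ = Real.exp (d * eps0 n ε) := (Real.exp_nat_mul _ _).symm
    _ ≤ Real.exp 1 := by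
        refine Real.exp_le_exp.2 ?_
        calc (d : ℝ) * eps0 n ε ≤ 10 * Real.log n / ε * eps0 n ε := by gcongr
          _ = 10 * ε / Real.log n := by rw [eps0]; field_simp
          _ ≤ 1 := by rw [div_le_one (by linarith)]; linarith
    _ ≤ 3 := Real.exp_one_lt_three.le

/-- If the eigenvalues of `B` have a weak gap below `θ` and `B' ≤ B` loses an `ε` fraction of the
trace on the top eigenspace of `B`, then the excess over `c` drops geometrically. -/
theorem excess_le_of_trace_decrease {B B' : Matrix (Fin n) (Fin n) ℂ} (hB : B.PosSemidef)
    (hB' : B'.PosSemidef) (hBB' : (B - B').PosSemidef) {K c θ e : ℝ} (hK : 0 < K) (hc : 0 ≤ c)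
    (he1 : e ≤ 1) (he : 0 ≤ e) (hcθ : K * e / 6 ≤ θ - c) (hε : 0 < ε)
    (hnorm : opNorm B < 2 * K)
    (hgap : eigSum hB.isHermitian c ≤ 2 * eigSum hB.isHermitian θ)
    (hdec : ε * eigSum hB.isHermitian θ ≤ ((B - B') * eigProj hB.isHermitian θ).trace.re) :
    excess hB'.isHermitian c ≤ (1 - e * ε / 48) * excess hB.isHermitian c := by
  have hlt := (opNorm_lt_iff hB (by positivity)).1 hnorm
  have h2K := posSemidef_smul_one_sub hB.isHermitian fun j => (hlt j).le
  have hMK : (((2 * K : ℝ) : ℂ) • (1 : Matrix (Fin n) (Fin n) ℂ) - (B - B')).PosSemidef := by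
    rw [← sub_add]; exact h2K.add hB'
  have h1 := trace_mul_le_of_projection hBB' hMK
    (posSemidef_eigProj hB'.isHermitian c).isHermitian (eigProj_mul_self _ _)
    (posSemidef_eigProj hB.isHermitian θ) (posSemidef_one_sub_eigProj hB.isHermitian θ)
  have h2 := excess_sub_le hB.isHermitian hB'.isHermitian c θ
  have h3 := excess_le_eigSum hB hc
  have h4 := trace_mul_nonneg hBB' (posSemidef_eigProj hB'.isHermitian c)
  have h5 := trace_mul_nonneg (posSemidef_one_sub_eigProj hB'.isHermitian c)
    (posSemidef_eigProj hB.isHermitian θ)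
  set u := ((B - B') * eigProj hB'.isHermitian c).trace.re
  set v := ((1 - eigProj hB'.isHermitian c) * eigProj hB.isHermitian θ).trace.re
  have h6 : K * e / 6 * v ≤ (θ - c) * v := mul_le_mul_of_nonneg_right hcθ h5
  -- The factor e/24 matches the v terms exactly; for the u terms e ≤ 12 would suffice. The gap
  -- hypothesis costs another factor 2, whence 48.
  have h7 : e / 24 * (2 * u + 2 * (2 * K) * v) ≤ u + K * e / 6 * v := by nlinarith
  have h8 : ε * (excess hB.isHermitian c / 2) ≤ 2 * u + 2 * (2 * K) * v := by
    refine le_trans ?_ (hdec.trans h1)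
    gcongr; linarith
  have h9 := mul_le_mul_of_nonneg_left h8 (show 0 ≤ e / 24 by linarith)
  linarith

/-- Here d is the number of successful threshold tests. The level c depends only on the pair (phase
value, d), which is what lets different iterations share one potential. -/
theorem Iteration.progress (hA : ∀ i, (A i).PosSemidef) (hn : 3 ≤ n) (hε : 0 < ε)
    (hε' : ε ≤ 1 / 10) {s s' : State n}
    (hk : opNorm (PhiStar A (dualVar A s.X)) < (1 + eps0 n ε) ^ (s.k + 1))
    (h : Iteration ε (fun i => (hA i).isHermitian) s s') :
    (PhiStar A (dualVar A s.X) - PhiStar A (dualVar A s'.X)).PosSemidef ∧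
    ∃ d : ℕ, (d : ℝ) ≤ 10 * Real.log n / ε ∧
      ∀ c, c = (1 + eps0 n ε) ^ (s'.k - d - 1) →
      excess (isHermitian_PhiStar (fun i => (hA i).isHermitian) (dualVar A s'.X)) c ≤
        (1 - eps0 n ε * ε / 48) *
          excess (isHermitian_PhiStar (fun i => (hA i).isHermitian) (dualVar A s.X)) c ∧
      (1 + eps0 n ε) ^ s'.k * (eps0 n ε / 6) ≤
        excess (isHermitian_PhiStar (fun i => (hA i).isHermitian) (dualVar A s.X)) c ∧
      excess (isHermitian_PhiStar (fun i => (hA i).isHermitian) (dualVar A s.X)) c ≤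
        (1 + eps0 n ε) ^ s'.k * (2 * n) := by
  obtain ⟨-, hph, thr, lam, hthr, hstep, hX⟩ := h
  have hq := eps0_pos hn hε
  have hq1 : eps0 n ε ≤ 1 := (eps0_le hn).trans (by nlinarith)
  have hB := posSemidef_PhiStar hA (dualVar_nonneg (A := A) s.X)
  have hB' := posSemidef_PhiStar hA (dualVar_nonneg (A := A) s'.X)
  have hhi := hph.opNorm_lt hk
  have hlo := not_lt.1 hph.2.2
  set K := (1 + eps0 n ε) ^ s'.k with hK_def
  have hK : 0 < K := by positivity
  have hhi2 : opNorm (PhiStar A (dualVar A s.X)) < 2 * K := by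
    refine hhi.trans_le ?_
    rw [zpow_add₀ (by positivity), zpow_one, mul_comm]
    gcongr; linarith
  obtain ⟨d, hd⟩ : ∃ d : ℕ, thr = s'.k - d := ⟨(s'.k - thr).toNat, by have := hthr.1; omega⟩
  subst hd
  have hdle := steps_mul_log_le hA (dualVar_nonneg (A := A) s.X) hε hq hq1 (by linarith) hlo hhi hn
    d hthr.2.1
  set θ := (1 + eps0 n ε) ^ (s'.k - d) with hθ_def
  have hθ0 : 0 < θ := by positivity
  have hθK : θ ≤ K := zpow_le_zpow_right₀ (by linarith) (by omega)
  have hKθ : K ≤ 3 * θ := by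
    have : K = (1 + eps0 n ε) ^ d * θ := by
      rw [hK_def, hθ_def, ← zpow_natCast, ← zpow_add₀ (by positivity)]; congr 1; ring
    rw [this]
    exact mul_le_mul_of_nonneg_right (pow_le_three hn hε hε' hdle) hθ0.le
  have hP := posSemidef_eigProj (isHermitian_PhiStar (fun i => (hA i).isHermitian)
    (dualVar A s.X)) θ
  set P := eigProj (isHermitian_PhiStar (fun i => (hA i).isHermitian) (dualVar A s.X)) θ
    with hP_def
  have hSeq : eigSum hB.isHermitian θ =
      ∑ i, dualVar A s.X i i * (A i * P).trace.re := by
    rw [eigSum_eq_trace, ← trace_PhiStar_mul]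
  have hSpos := hK.trans_le (le_eigSum hB hK hlo hθK)
  obtain ⟨hlam, hdec⟩ := hstep.decrease hε (by linarith) (fun i => trace_mul_nonneg (hA i) hP)
    (dualVar_nonneg s.X) (hSeq ▸ hSpos)
  have hdiff : ∀ i, (dualVar A s.X - dualVar A s'.X) i i =
      dualVar A s.X i i * (1 - Real.exp (-(lam * (A i * P).trace.re))) := fun i => by
    rw [Matrix.sub_apply, hX, dualVar_add_smul]; ring
  have hBB' : (PhiStar A (dualVar A s.X) - PhiStar A (dualVar A s'.X)).PosSemidef := by
    rw [PhiStar_sub]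
    refine posSemidef_PhiStar hA fun i => ?_
    rw [hdiff]
    refine mul_nonneg (dualVar_nonneg _ _) ?_
    have := mul_nonneg hlam (trace_mul_nonneg (hA i) hP)
    linarith [Real.exp_le_one_iff.2 (neg_nonpos.2 this)]
  refine ⟨hBB', d, hdle, fun c hc => ?_⟩
  have hc' : c * (1 + eps0 n ε) = θ := by
    rw [hc, hθ_def, ← zpow_add_one₀ (by positivity), sub_add_cancel]
  have hc0 : 0 < c := by rw [hc]; positivity
  -- θ − c = cε₀ exactly, and c ≥ θ/2 ≥ K/6.
  have hcθ : K * eps0 n ε / 6 ≤ θ - c := by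
    have h1 : c * eps0 n ε ≤ c := mul_le_of_le_one_right hc0.le hq1
    have h2 : K * eps0 n ε ≤ 6 * c * eps0 n ε :=
      mul_le_mul_of_nonneg_right (by linarith) hq.le
    linarith
  have hgap : eigSum hB.isHermitian c ≤ 2 * eigSum hB.isHermitian θ := by
    have h1 := hthr.2.2
    rw [ThrTest, not_le, ← hc, ← hθ_def] at h1
    refine h1.le.trans ?_
    gcongr; linarith
  have hdec' : ε * eigSum hB.isHermitian θ ≤
      ((PhiStar A (dualVar A s.X) - PhiStar A (dualVar A s'.X)) *
        eigProj hB.isHermitian θ).trace.re := by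
    rw [PhiStar_sub, trace_PhiStar_mul, hSeq]
    simp only [hdiff]
    exact hdec
  refine ⟨excess_le_of_trace_decrease hB hB' hBB' hK hc0.le hq1 hq.le hcθ hε hhi2 hgap hdec', ?_,
    ?_⟩
  · refine le_trans ?_ (sub_le_excess hB hK hlo c)
    linarith
  · refine (excess_le_eigSum hB hc0.le).trans ((eigSum_le hB (by positivity) hhi2 c).trans ?_)
    linarith

theorem exists_iteration (hA : ∀ i, (A i).PosSemidef) (hne : ∀ i, A i ≠ 0) (hm : 1 ≤ m)
    (hn : 3 ≤ n) (hε : 0 < ε) (hε' : ε ≤ 1 / 10) {s : State n}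
    (hk : opNorm (PhiStar A (dualVar A s.X)) < (1 + eps0 n ε) ^ (s.k + 1))
    (hs : ¬ Halted ε A s) : ∃ s', Iteration ε (fun i => (hA i).isHermitian) s s' := by
  have hq := eps0_pos hn hε
  have hq1 : eps0 n ε ≤ 1 := (eps0_le hn).trans (by nlinarith)
  have hY := dualVar_nonneg (A := A) s.X
  have hpos : 0 < opNorm (PhiStar A (dualVar A s.X)) := by
    refine lt_of_lt_of_le ?_ (mul_opNorm_le hA hY ⟨0, hm⟩)
    refine mul_pos (by rw [dualVar_apply]; positivity) ?_
    rw [opNorm, norm_pos_iff]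
    simpa using hne _
  obtain ⟨k', hk'⟩ := exists_phaseUpdate hq hpos s.k
  obtain ⟨thr, hthr⟩ := exists_thresholdSearch hA hY hε hq hq1 (by linarith)
    (not_lt.1 hk'.2.2) (hk'.opNorm_lt hk) hn
  obtain ⟨lam, hlam⟩ := exists_stepLength (A := A) (ε := ε) (dualVar A s.X)
    (eigProj (isHermitian_PhiStar (fun i => (hA i).isHermitian) (dualVar A s.X))
      ((1 + eps0 n ε) ^ thr)) hm (by linarith)
    (Finset.sum_nonneg fun i _ => mul_nonneg (hY i)
      (trace_mul_nonneg (hA i) (posSemidef_eigProj _ _)))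
  exact ⟨⟨_, k'⟩, hs, hk', thr, lam, hthr, hlam, rfl⟩

theorem exists_isInitial (hA : ∀ i, (A i).PosSemidef) (hne : ∀ i, A i ≠ 0) (hm : 1 ≤ m)
    (hn : 3 ≤ n) (hε : 0 < ε) : ∃ s, IsInitial ε A s := by
  have hq := eps0_pos hn hε
  have hpos : 0 < opNorm (PhiStar A 1) := by
    refine lt_of_lt_of_le ?_ (mul_opNorm_le hA (Y := 1) (by simp) ⟨0, hm⟩)
    rw [one_apply_eq, one_mul, opNorm, norm_pos_iff]
    simpa using hne _
  obtain ⟨k, hk1, hk2⟩ := exists_mem_Ico_zpow hpos (show 1 < 1 + eps0 n ε by linarith)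
  exact ⟨⟨0, k⟩, rfl, hk1, hk2⟩

end Step

/-! ### Counting the decay steps of a nonincreasing potential. -/

section Counting

/-- Just before the last time in S the potential is still at least `lo`, yet it has already shrunk
|S| − 1 times from at most `hi`. The bounds are needed only at times in S. -/
theorem card_le_of_geometric_decay {Ψ : ℕ → ℝ} {S : Finset ℕ} {T : ℕ} {δ lo hi : ℝ}
    (hlo : 0 < lo) (hδ : 0 < δ) (hδ1 : δ ≤ 1) (hST : S ⊆ Finset.range T)
    (hanti : ∀ t < T, Ψ (t + 1) ≤ Ψ t) (hdec : ∀ t ∈ S, Ψ (t + 1) ≤ (1 - δ) * Ψ t)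
    (hge : ∀ t ∈ S, lo ≤ Ψ t) (hle : ∀ t ∈ S, Ψ t ≤ hi) (hlohi : lo ≤ hi) :
    (S.card : ℝ) ≤ 1 + Real.log (hi / lo) / δ := by
  have hlog : 0 ≤ Real.log (hi / lo) := Real.log_nonneg ((one_le_div hlo).2 hlohi)
  -- The first alternative covers the times before S begins, where no upper bound on the potential
  -- is available.
  have key : ∀ t ≤ T, (S.filter (· < t)).card = 0 ∨
      Ψ t ≤ (1 - δ) ^ (S.filter (· < t)).card * hi := by
    intro t
    induction t with
    | zero => intro _; left; simp
    | succ t ih =>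
      intro ht
      have ih := ih (by omega)
      by_cases hmem : t ∈ S
      · have hins : S.filter (· < t + 1) = insert t (S.filter (· < t)) := by
          ext x
          simp only [Finset.mem_filter, Finset.mem_insert]
          constructor
          · rintro ⟨h1, h2⟩
            rcases Nat.lt_succ_iff_lt_or_eq.1 h2 with h | h
            · exact Or.inr ⟨h1, h⟩
            · exact Or.inl h
          · rintro (rfl | ⟨h1, h2⟩)
            · exact ⟨hmem, by omega⟩
            · exact ⟨h1, by omega⟩
        have hΨ : Ψ t ≤ (1 - δ) ^ (S.filter (· < t)).card * hi := by
          rcases ih with h | h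
          · rw [h, pow_zero, one_mul]; exact hle t hmem
          · exact h
        right
        rw [hins, Finset.card_insert_of_notMem (by simp), pow_succ', mul_assoc]
        exact (hdec t hmem).trans (mul_le_mul_of_nonneg_left hΨ (by linarith))
      · have hins : S.filter (· < t + 1) = S.filter (· < t) := by
          refine Finset.filter_congr fun x hx => ?_
          have : x ≠ t := fun h => hmem (h ▸ hx)
          omega
        rw [hins]
        exact ih.imp id fun h => (hanti t (by omega)).trans h
  rcases S.eq_empty_or_nonempty with rfl | hne
  · simp only [Finset.card_empty, Nat.cast_zero]; positivity
  set t := S.max' hne with ht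
  have htS : t ∈ S := S.max'_mem hne
  have hcard : (S.filter (· < t)).card = S.card - 1 := by
    rw [← Finset.card_erase_of_mem htS]
    congr 1
    ext x
    simp only [Finset.mem_filter, Finset.mem_erase]
    exact ⟨fun h => ⟨h.2.ne, h.1⟩, fun h => ⟨h.2, lt_of_le_of_ne (S.le_max' x h.2) h.1⟩⟩
  have hcpos := hne.card_pos
  have hΨ : lo ≤ (1 - δ) ^ (S.card - 1) * hi := by
    refine (hge t htS).trans ?_
    rcases key t (by have := Finset.mem_range.1 (hST htS); omega) with h | h
    · rw [show S.card - 1 = 0 by omega, pow_zero, one_mul]; exact hle t htS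
    · rwa [hcard] at h
  have h1 : (1 - δ) ^ (S.card - 1) ≤ Real.exp (-(((S.card - 1 : ℕ) : ℝ) * δ)) := by
    rw [← mul_neg, Real.exp_nat_mul]
    refine pow_le_pow_left₀ (by linarith) ?_ _
    linarith [Real.add_one_le_exp (-δ)]
  have h2 : Real.exp (((S.card - 1 : ℕ) : ℝ) * δ) ≤ hi / lo := by
    rw [le_div_iff₀ hlo]
    have h3 := hΨ.trans (mul_le_mul_of_nonneg_right h1 (hlo.le.trans hlohi))
    calc Real.exp (((S.card - 1 : ℕ) : ℝ) * δ) * lo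
        ≤ Real.exp (((S.card - 1 : ℕ) : ℝ) * δ) *
          (Real.exp (-(((S.card - 1 : ℕ) : ℝ) * δ)) * hi) := by gcongr
      _ = hi := by rw [← mul_assoc, ← Real.exp_add]; simp
  have h3 := (Real.le_log_iff_exp_le (div_pos (hlo.trans_le hlohi) hlo)).2 h2
  rw [← le_div_iff₀ hδ, Nat.cast_sub hcpos] at h3
  push_cast at h3
  linarith

end Counting

/-! ### Whole executions: iterations per phase, number of phases, total length. -/

section Execution

variable {n m : ℕ} {A : Fin m → Matrix (Fin n) (Fin n) ℂ} {ε : ℝ}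

theorem IsExecution.opNorm_lt (hA : ∀ i, (A i).PosSemidef) (hn : 3 ≤ n) (hε : 0 < ε)
    (hε' : ε ≤ 1 / 10) {T : ℕ} {s : ℕ → State n}
    (h : IsExecution ε (fun i => (hA i).isHermitian) T s) (t : ℕ) (ht : t ≤ T) :
    opNorm (PhiStar A (dualVar A (s t).X)) < (1 + eps0 n ε) ^ ((s t).k + 1) := by
  induction t with
  | zero =>
    rw [h.1.1, dualVar_zero]
    exact h.1.2.2
  | succ t ih =>
    have ih := ih (by omega)
    have hit := h.2 t (by omega)
    have hprog := (hit.progress hA hn hε hε' ih).1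
    exact (opNorm_mono (posSemidef_PhiStar hA (dualVar_nonneg _)) hprog).trans_lt
      (hit.2.1.opNorm_lt ih)

theorem IsExecution.phase_antitone {hA : ∀ i, (A i).IsHermitian} {T : ℕ} {s : ℕ → State n}
    (h : IsExecution ε hA T s) {t u : ℕ} (htu : t ≤ u) (hu : u ≤ T) : (s u).k ≤ (s t).k := by
  induction u, htu using Nat.le_induction with
  | base => exact le_rfl
  | succ u _ ih => exact (h.2 u (by omega)).2.1.1.trans (ih (by omega))

/-- The iterations of a phase are split by their search depth; each class has a fixed level c, so
the decay count applies to it, even if its members are interleaved with those of other classes. -/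
theorem IsExecution.phaseCount_le (hA : ∀ i, (A i).PosSemidef) (hn : 3 ≤ n) (hε : 0 < ε)
    (hε' : ε ≤ 1 / 10) {T : ℕ} {s : ℕ → State n}
    (h : IsExecution ε (fun i => (hA i).isHermitian) T s) (k : ℤ) :
    (phaseCount T s k : ℝ) ≤ (10 * Real.log n / ε + 1) *
      (1 + Real.log (12 * n / eps0 n ε) / (eps0 n ε * ε / 48)) := by
  have hq := eps0_pos hn hε
  have hq1 : eps0 n ε ≤ 1 := (eps0_le hn).trans (by nlinarith)
  have hn' : (3 : ℝ) ≤ n := by exact_mod_cast hn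
  have hprog := fun t (ht : t < T) =>
    (h.2 t ht).progress hA hn hε hε' (h.opNorm_lt hA hn hε hε' t ht.le)
  have hD := fun t (ht : t < T) => (hprog t ht).2
  choose! D hD using hD
  set S : Finset ℕ := {t ∈ Finset.range T | (s (t + 1)).k = k} with hS
  set J := ⌊10 * Real.log n / ε⌋₊ with hJ
  have hL := one_le_log hn
  have hmaps : ∀ t ∈ S, D t ∈ Finset.range (J + 1) := fun t ht => by
    have htT := Finset.mem_range.1 (Finset.mem_filter.1 ht).1
    exact Finset.mem_range.2 (Nat.lt_succ_of_le (Nat.le_floor (hD t htT).1))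
  set K := (1 + eps0 n ε) ^ k with hK_def
  have hK : 0 < K := by positivity
  have hfiber : ∀ b ∈ Finset.range (J + 1), ((S.filter (fun t => D t = b)).card : ℝ) ≤
      1 + Real.log (12 * n / eps0 n ε) / (eps0 n ε * ε / 48) := fun b _ => by
    have hmem : ∀ t ∈ S.filter (fun t => D t = b), t < T ∧ (s (t + 1)).k = k ∧ D t = b :=
      fun t ht => by
        obtain ⟨h1, h2⟩ := Finset.mem_filter.1 ht
        obtain ⟨h1, h3⟩ := Finset.mem_filter.1 h1
        exact ⟨Finset.mem_range.1 h1, h3, h2⟩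
    have hmain : ∀ t ∈ S.filter (fun t => D t = b), _ := fun t ht =>
      (hD t (hmem t ht).1).2 ((1 + eps0 n ε) ^ (k - b - 1))
        (by rw [(hmem t ht).2.1, (hmem t ht).2.2])
    have hratio : 12 * n / eps0 n ε = K * (2 * n) / (K * (eps0 n ε / 6)) := by
      field_simp; norm_num
    rw [hratio]
    refine card_le_of_geometric_decay (T := T) (Ψ := fun t => excess (isHermitian_PhiStar
      (fun i => (hA i).isHermitian) (dualVar A (s t).X)) ((1 + eps0 n ε) ^ (k - b - 1)))
      (by positivity) (by positivity) ?_ ?_ ?_ ?_ ?_ ?_ ?_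
    · nlinarith
    · exact fun t ht => Finset.mem_range.2 (hmem t ht).1
    · exact fun t ht => excess_mono _ _ (hprog t ht).1 _
    · exact fun t ht => (hmain t ht).1
    · intro t ht
      have := (hmain t ht).2.1
      rwa [(hmem t ht).2.1] at this
    · intro t ht
      have := (hmain t ht).2.2
      rwa [(hmem t ht).2.1] at this
    · gcongr; linarith
  have hbound : 0 ≤ 1 + Real.log (12 * n / eps0 n ε) / (eps0 n ε * ε / 48) := by
    have : 0 ≤ Real.log (12 * n / eps0 n ε) :=
      Real.log_nonneg ((one_le_div hq).2 (by linarith))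
    positivity
  calc (phaseCount T s k : ℝ) = ∑ b ∈ Finset.range (J + 1),
        ((S.filter (fun t => D t = b)).card : ℝ) := by
        rw [← Nat.cast_sum, ← Finset.card_eq_sum_card_fiberwise hmaps]; rfl
    _ ≤ ∑ _b ∈ Finset.range (J + 1), _ := Finset.sum_le_sum hfiber
    _ = ((J : ℝ) + 1) * _ := by
        rw [Finset.sum_const, Finset.card_range, nsmul_eq_mul]; push_cast; rfl
    _ ≤ _ := by
        refine mul_le_mul_of_nonneg_right ?_ hbound
        linarith [Nat.floor_le (show 0 ≤ 10 * Real.log n / ε by positivity)]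

theorem SpecialForm.le_opNorm (hS : SpecialForm ε A) (hε : 0 < ε) (i : Fin m) :
    1 / ((m : ℝ) ^ 2 / ε ^ 2) ≤ opNorm (A i) := by
  have hm : 0 < (m : ℝ) := by exact_mod_cast i.pos
  obtain ⟨j, hj⟩ : ∃ j, (hS.posSemidef i).isHermitian.eigenvalues j ≠ 0 := by
    by_contra! h0
    exact hS.ne_zero i ((IsHermitian.eigenvalues_eq_zero_iff _).1 (funext h0))
  by_contra! hlt
  exact absurd ((opNorm_lt_iff (hS.posSemidef i) (by positivity)).1 hlt j)
    (not_lt.2 (hS.eigenvalue_ge i j hj))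

theorem SpecialForm.opNorm_PhiStar_one_le (hS : SpecialForm ε A) : opNorm (PhiStar A 1) ≤ m := by
  have : PhiStar A 1 = ∑ i, A i := by simp [PhiStar]
  rw [this]
  refine (opNorm_sum_le A).trans ((Finset.sum_le_sum fun i _ => hS.norm_le_one i).trans ?_)
  simp

/-- Some y_i is at least the average, which exceeds m^(−1/ε)/m, and the single term y_iA_i already
has norm at least y_i/γ. -/
theorem SpecialForm.le_opNorm_of_not_halted (hS : SpecialForm ε A) (hε : 0 < ε) (hm : 1 ≤ m)
    {s : State n} (hs : ¬ Halted ε A s) :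
    1 / (m : ℝ) ^ (1 / ε) / m * (1 / ((m : ℝ) ^ 2 / ε ^ 2)) ≤
      opNorm (PhiStar A (dualVar A s.X)) := by
  have hm' : 0 < (m : ℝ) := by exact_mod_cast hm
  obtain ⟨i, hi⟩ : ∃ i, 1 / (m : ℝ) ^ (1 / ε) / m ≤ dualVar A s.X i i := by
    by_contra! hlt
    refine hs ?_
    calc (dualVar A s.X).trace ≤ ∑ _i : Fin m, 1 / (m : ℝ) ^ (1 / ε) / m :=
          Finset.sum_le_sum fun i _ => (hlt i).le
      _ = 1 / (m : ℝ) ^ (1 / ε) := by simp; field_simp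
  refine le_trans ?_ (mul_opNorm_le hS.posSemidef (dualVar_nonneg s.X) i)
  exact mul_le_mul hi (hS.le_opNorm hε i) (by positivity) (dualVar_nonneg _ _)

/-- For m = 1 the initial trace is 1 and so is the stopping bound. Excluding this case makes log m
bounded away from 0, so it can absorb constants. -/
theorem two_le_of_not_halted (hm : 1 ≤ m) {s : State n} (h0 : s.X = 0) (hs : ¬ Halted ε A s) :
    2 ≤ m := by
  by_contra hlt
  obtain rfl : m = 1 := by omega
  refine hs ?_
  rw [Halted, h0, dualVar_zero]
  simp

theorem IsExecution.phases_le (hS : SpecialForm ε A) (hm : 2 ≤ m) (hn : 3 ≤ n) (hε : 0 < ε)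
    (hε' : ε ≤ 1 / 10) {T : ℕ} {s : ℕ → State n}
    (h : IsExecution ε (fun i => (hS.posSemidef i).isHermitian) (T + 1) s) :
    (((s 0).k - (s (T + 1)).k : ℤ) : ℝ) ≤ 11 * (Real.log m * Real.log n ^ 2 / ε ^ 3) := by
  have hq := eps0_pos hn hε
  have hq1 : eps0 n ε ≤ 1 := (eps0_le hn).trans (by nlinarith)
  have hL := one_le_log hn
  have hm' : (2 : ℝ) ≤ m := by exact_mod_cast hm
  have hm0 : (0 : ℝ) < m := by linarith
  have hit := h.2 T (by omega)
  have h1 := Real.log_le_log (by positivity) (h.1.2.1.trans hS.opNorm_PhiStar_one_le)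
  have h2 := Real.log_le_log (by positivity)
    ((hS.le_opNorm_of_not_halted hε (by omega) hit.1).trans
      (hit.2.1.opNorm_lt (h.opNorm_lt hS.posSemidef hn hε hε' T (by omega))).le)
  rw [Real.log_zpow] at h1 h2
  rw [Real.log_mul (by positivity) (by positivity), Real.log_div (by positivity) hm0.ne',
    one_div, Real.log_inv, Real.log_rpow hm0, one_div (_ / _), Real.log_inv,
    Real.log_div (by positivity) (by positivity), Real.log_pow, Real.log_pow] at h2
  push_cast at h1 h2 ⊢
  have hlm : 0.69 < Real.log m :=
    lt_of_lt_of_le (by linarith [Real.log_two_gt_d9]) (Real.log_le_log (by norm_num) hm')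
  have hlε : -(1 / ε) ≤ Real.log ε := by
    have := Real.log_le_sub_one_of_pos (one_div_pos.2 hε)
    rw [one_div, Real.log_inv, ← one_div] at this
    linarith
  have hw : 10 ≤ 1 / ε := by rw [le_div_iff₀ hε]; linarith
  have hlq : eps0 n ε / 2 ≤ Real.log (1 + eps0 n ε) := by
    have h6 := Real.one_sub_inv_le_log_of_pos (show 0 < 1 + eps0 n ε by linarith)
    have : (1 + eps0 n ε)⁻¹ ≤ 1 - eps0 n ε / 2 := by
      rw [inv_le_iff_one_le_mul₀ (by linarith)]
      nlinarith
    linarith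
  set x : ℝ := (s 0).k - (s (T + 1)).k with hx
  set w := 1 / ε with hw_def
  set l := Real.log m with hl_def
  set a := Real.log n with ha_def
  have he : eps0 n ε = 1 / (w ^ 2 * a ^ 2) := by
    rw [eps0, hw_def, ← ha_def]; field_simp
  -- The logarithms of the two norm bounds are subtracted. The −1 is there because the final norm is
  -- only known to be below (1+ε₀)^(k_f+1).
  have h3 : (x - 1) * Real.log (1 + eps0 n ε) ≤ 5 * (w * l) := by
    have h4 : (x - 1) * Real.log (1 + eps0 n ε) ≤ w * l + 4 * l + 2 * w := by
      rw [hx]; linarith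
    nlinarith
  have hgoal : l * a ^ 2 / ε ^ 3 = l * a ^ 2 * w ^ 3 := by
    rw [hw_def]; field_simp
  rw [hgoal]
  have hbig : 1 ≤ l * a ^ 2 * w ^ 3 := by
    have h5 : (1 : ℝ) ≤ a ^ 2 := one_le_pow₀ hL
    have h6 : (10 : ℝ) ^ 3 ≤ w ^ 3 := pow_le_pow_left₀ (by norm_num) hw 3
    calc (1 : ℝ) ≤ 0.69 * 1 * 10 ^ 3 := by norm_num
      _ ≤ l * a ^ 2 * w ^ 3 := by gcongr
  rcases le_or_gt x 1 with hx1 | hx1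
  · linarith
  · have h7 : (x - 1) * (eps0 n ε / 2) ≤ 5 * (w * l) :=
      (mul_le_mul_of_nonneg_left hlq (by linarith)).trans h3
    have h8 : x - 1 ≤ 10 * (l * a ^ 2 * w ^ 3) := by
      rw [he] at h7
      have hpos : 0 < w ^ 2 * a ^ 2 := by positivity
      have h9 := mul_le_mul_of_nonneg_right h7 hpos.le
      have h10 : (x - 1) * (1 / (w ^ 2 * a ^ 2) / 2) * (w ^ 2 * a ^ 2) = (x - 1) / 2 := by
        field_simp
      rw [h10] at h9
      linarith
    linarith

theorem iteration_bound_le (hn : 3 ≤ n) (hε : 0 < ε) (hε' : ε ≤ 1 / 10) :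
    (10 * Real.log n / ε + 1) *
      (1 + Real.log (12 * n / eps0 n ε) / (eps0 n ε * ε / 48)) ≤
      4400 * (Real.log n ^ 4 / ε ^ 5) := by
  have hL := one_le_log hn
  have hn' : (3 : ℝ) ≤ n := by exact_mod_cast hn
  have hlogL := Real.log_le_sub_one_of_pos (show 0 < Real.log n by linarith)
  have hlogε := Real.log_le_sub_one_of_pos (one_div_pos.2 hε)
  have hlog12 := Real.log_le_sub_one_of_pos (show (0 : ℝ) < 12 by norm_num)
  have hlog : Real.log (12 * n / eps0 n ε) =
      Real.log 12 + Real.log n + 2 * Real.log (Real.log n) + 2 * Real.log (1 / ε) := by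
    rw [eps0, Real.log_div (by positivity) (by positivity),
      Real.log_mul (by norm_num) (by positivity), Real.log_div (by positivity) (by positivity),
      Real.log_pow, Real.log_pow, one_div, Real.log_inv]
    push_cast
    ring
  have hw : 10 ≤ 1 / ε := by rw [le_div_iff₀ hε]; linarith
  set w := 1 / ε with hw_def
  set a := Real.log n with ha_def
  have e1 : 10 * a / ε = 10 * a * w := by rw [hw_def]; ring
  have e2 : eps0 n ε * ε / 48 = (48 * a ^ 2 * w ^ 3)⁻¹ := by
    rw [eps0, hw_def, ← ha_def]; field_simp
  have e3 : a ^ 4 / ε ^ 5 = a ^ 4 * w ^ 5 := by rw [hw_def]; field_simp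
  have haw : 10 ≤ a * w := by nlinarith
  have haw1 : a * 10 ≤ a * w := by gcongr
  have haw2 : w ≤ a * w := le_mul_of_one_le_left (by linarith) hL
  -- Even this crude bound on the logarithm suffices; the final constant is 11·(1 + 8·48) = 4235.
  have hlog' : Real.log (12 * n / eps0 n ε) ≤ 8 * (a * w) := by rw [hlog]; linarith
  rw [e1, e2, e3, div_inv_eq_mul]
  have h1 : 1 ≤ a ^ 3 * w ^ 4 :=
    one_le_mul_of_one_le_of_one_le (one_le_pow₀ hL) (one_le_pow₀ (by linarith))
  calc (10 * a * w + 1) * (1 + Real.log (12 * n / eps0 n ε) * (48 * a ^ 2 * w ^ 3))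
      ≤ (10 * a * w + a * w) * (a ^ 3 * w ^ 4 + 8 * (a * w) * (48 * a ^ 2 * w ^ 3)) := by
        have : 0 ≤ Real.log (12 * n / eps0 n ε) := by
          refine Real.log_nonneg ((one_le_div (eps0_pos hn hε)).2 ?_)
          have := eps0_le (ε := ε) hn
          nlinarith
        gcongr
        linarith
    _ = 4235 * (a ^ 4 * w ^ 5) := by ring
    _ ≤ 4400 * (a ^ 4 * w ^ 5) := by gcongr; norm_num

theorem phase_bound_le (hn : 3 ≤ n) (hε : 0 < ε) (hε' : ε ≤ 1 / 10) :
    4400 * (Real.log n ^ 4 / ε ^ 5) ≤ 10 ^ 8 * (Real.log n ^ 2 / (eps1 n ε ^ 9 * ε)) := by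
  have hL := one_le_log hn
  have hw : 1 ≤ 1 / ε := by rw [le_div_iff₀ hε]; linarith
  have e1 : Real.log n ^ 4 / ε ^ 5 = Real.log n ^ 4 * (1 / ε) ^ 5 := by field_simp
  -- 19683 = 3⁹ comes from the factor 3 in ε₁, and 4400·19683 < 10⁸.
  have e2 : Real.log n ^ 2 / (eps1 n ε ^ 9 * ε) =
      Real.log n ^ 11 * (1 / ε) ^ 10 / 19683 := by
    rw [eps1]; field_simp; norm_num
  rw [e1, e2]
  have h1 : Real.log n ^ 4 * (1 / ε) ^ 5 ≤ Real.log n ^ 11 * (1 / ε) ^ 10 :=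
    mul_le_mul (pow_le_pow_right₀ hL (by norm_num)) (pow_le_pow_right₀ hw (by norm_num))
      (by positivity) (by positivity)
  have h2 : 0 ≤ Real.log n ^ 4 * (1 / ε) ^ 5 := by positivity
  linarith

theorem IsExecution.length_eq_sum {hA : ∀ i, (A i).IsHermitian} {T : ℕ} {s : ℕ → State n}
    (h : IsExecution ε hA T s) :
    T = ∑ k ∈ Finset.Icc (s T).k (s 0).k, phaseCount T s k := by
  unfold phaseCount
  rw [← Finset.card_eq_sum_card_fiberwise (f := fun t => (s (t + 1)).k), Finset.card_range]
  intro t ht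
  have ht := Finset.mem_range.1 (Finset.mem_coe.1 ht)
  exact Finset.mem_coe.2 (Finset.mem_Icc.2
    ⟨h.phase_antitone (by omega) le_rfl, h.phase_antitone (by omega) (by omega)⟩)

/-- At most 11 + 1 units of log m·log²n/ε³ phase values, times the sharp per-phase bound, give order
log⁶n·log m/ε⁸; the stated exponents leave room. -/
theorem IsExecution.length_le (hS : SpecialForm ε A) (hm : 2 ≤ m) (hn : 3 ≤ n) (hε : 0 < ε)
    (hε' : ε ≤ 1 / 10) {T : ℕ} {s : ℕ → State n}
    (h : IsExecution ε (fun i => (hS.posSemidef i).isHermitian) (T + 1) s) :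
    ((T + 1 : ℕ) : ℝ) ≤ 10 ^ 8 * (Real.log n ^ 13 * Real.log m / ε ^ 13) := by
  have hphases := h.phases_le hS hm hn hε hε'
  have hL := one_le_log hn
  have hw : 10 ≤ 1 / ε := by rw [le_div_iff₀ hε]; linarith
  have hlm : 0.69 < Real.log m :=
    lt_of_lt_of_le (by linarith [Real.log_two_gt_d9])
      (Real.log_le_log (x := 2) (by norm_num) (by exact_mod_cast hm))
  have hk := h.phase_antitone (Nat.zero_le _) le_rfl
  have e1 : Real.log m * Real.log n ^ 2 / ε ^ 3 =
      Real.log m * Real.log n ^ 2 * (1 / ε) ^ 3 := by field_simp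
  have e2 : Real.log n ^ 4 / ε ^ 5 = Real.log n ^ 4 * (1 / ε) ^ 5 := by field_simp
  have e3 : Real.log n ^ 13 * Real.log m / ε ^ 13 =
      Real.log n ^ 13 * Real.log m * (1 / ε) ^ 13 := by field_simp
  rw [e1] at hphases
  rw [e3]
  set w := 1 / ε
  set l := Real.log m
  set a := Real.log n
  have hbig : 1 ≤ l * a ^ 2 * w ^ 3 := by
    have h5 : (1 : ℝ) ≤ a ^ 2 := one_le_pow₀ hL
    have h6 : (10 : ℝ) ^ 3 ≤ w ^ 3 := pow_le_pow_left₀ (by norm_num) hw 3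
    calc (1 : ℝ) ≤ 0.69 * 1 * 10 ^ 3 := by norm_num
      _ ≤ l * a ^ 2 * w ^ 3 := by gcongr
  calc ((T + 1 : ℕ) : ℝ)
      = ∑ k ∈ Finset.Icc (s (T + 1)).k (s 0).k, (phaseCount (T + 1) s k : ℝ) := by
        exact_mod_cast h.length_eq_sum
    _ ≤ ∑ _k ∈ Finset.Icc (s (T + 1)).k (s 0).k, 4400 * (a ^ 4 * w ^ 5) :=
        Finset.sum_le_sum fun k _ => e2 ▸
          (h.phaseCount_le hS.posSemidef hn hε hε' k).trans (iteration_bound_le hn hε hε')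
    _ = ((((s 0).k - (s (T + 1)).k : ℤ) : ℝ) + 1) * (4400 * (a ^ 4 * w ^ 5)) := by
        rw [Finset.sum_const, Int.card_Icc, nsmul_eq_mul, ← Int.cast_natCast (R := ℝ),
          Int.toNat_of_nonneg (by omega)]
        push_cast
        ring
    _ ≤ (12 * (l * a ^ 2 * w ^ 3)) * (4400 * (a ^ 4 * w ^ 5)) := by
        gcongr; linarith
    _ = 52800 * (a ^ 6 * l * w ^ 8) := by ring
    _ ≤ 10 ^ 8 * (a ^ 13 * l * w ^ 13) := by
        gcongr
        · norm_num
        · norm_num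
        · linarith
        · norm_num

end Execution

end PosSDP
end

/-! ### Assembly of the bounds. -/

theorem mainTheorem2 :
    ∃ (C ε_max : ℝ) (n_min : ℕ), 0 < C ∧ 0 < ε_max ∧
      ∀ (n m : ℕ) (ε : ℝ) (A : Fin m → Matrix (Fin n) (Fin n) ℂ)
        (hS : PosSDP.SpecialForm ε A),
        n_min ≤ n → 1 ≤ m → 0 < ε → ε ≤ ε_max →
        -- the algorithm can be started
        (∃ s₀ : PosSDP.State n, PosSDP.IsInitial ε A s₀) ∧
        ∀ (T : ℕ) (s : ℕ → PosSDP.State n),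
          PosSDP.IsExecution ε (fun i => (hS.posSemidef i).isHermitian) T s →
          -- the execution has stopped or can be continued
          (PosSDP.Halted ε A (s T) ∨
            ∃ s' : PosSDP.State n,
              PosSDP.Iteration ε (fun i => (hS.posSemidef i).isHermitian) (s T) s') ∧
          -- the number of iterations for each fixed phase value
          (∀ k : ℤ, (PosSDP.phaseCount T s k : ℝ) ≤
            C * (Real.log n ^ 2 / (PosSDP.eps1 n ε ^ 9 * ε))) ∧
          -- the number of phases
          (((s 0).k - (s T).k : ℤ) : ℝ) ≤ C * (Real.log m * Real.log n ^ 2 / ε ^ 3) ∧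
          -- the total number of iterations
          (T : ℝ) ≤ C * (Real.log n ^ 13 * Real.log m / ε ^ 13) := by
  refine ⟨10 ^ 8, 1 / 10, 3, by norm_num, by norm_num, ?_⟩
  intro n m ε A hS hn hm hε hε'
  refine ⟨PosSDP.exists_isInitial hS.posSemidef hS.ne_zero hm hn hε, fun T s h => ?_⟩
  have hlm : 0 ≤ Real.log m := Real.log_natCast_nonneg m
  have hln : 0 ≤ Real.log n := Real.log_natCast_nonneg n
  refine ⟨or_iff_not_imp_left.2 fun hs => PosSDP.exists_iteration hS.posSemidef hS.ne_zero hm hn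
    hε hε' (h.opNorm_lt hS.posSemidef hn hε hε' T le_rfl) hs, fun k => ?_, ?_⟩
  · exact (h.phaseCount_le hS.posSemidef hn hε hε' k).trans
      ((PosSDP.iteration_bound_le hn hε hε').trans (PosSDP.phase_bound_le hn hε hε'))
  -- The norm lower bound needs a last iteration, and m ≥ 2 is deduced from the first one, so T = 0
  -- is separate.
  · rcases T with _ | T
    · rw [sub_self]
      constructor
      · push_cast; positivity
      · push_cast; positivity
    · have hm2 := PosSDP.two_le_of_not_halted hm h.1.1 (h.2 0 (by omega)).1
      refine ⟨(h.phases_le hS hm2 hn hε hε').trans ?_, h.length_le hS hm2 hn hε hε'⟩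
      gcongr
      norm_num
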